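/- **Theorem (Soft-DPG).** Consider a discounted Markov decision process with a measurable state space $\mathcal S$, action space $\mathbb R^m$ with the Euclidean norm, transition kernel $P(ds'\mid s,a)$, bounded measurable reward $R(s,a)$, discount factor $\gamma\in[0,1)$ and initial state distribution $\rho_0$. Let $\sigma>0$, and let $\pi_\theta:\mathcal S\to\mathbb R^m$, $\theta\in\mathbb R^d$, be a family of measurable deterministic policies. For each $\theta$ let $Q_\sigma^{\pi_\theta}$ be the unique bounded measurable solution of the $\sigma$-smoothed Bellman equation $$Q(s,a)=R(s,a)+\gamma\,\mathbb E_{s'\sim P(\cdot\mid s,a),\,w\sim\mathcal N(0,I)}\bigl[Q(s',\pi_\theta(s')+\sigma w)\bigr],$$ let $V_\sigma^{\pi_\theta}(s)=\mathbb E_{w\sim\mathcal N(0,I)}[Q_\sigma^{\pi_\theta}(s,\pi_\theta(s)+\sigma w)]$ and $J_\sigma(\theta)=\mathbb E_{s_0\sim\rho_0}[V_\sigma^{\pi_\theta}(s_0)]$. Let $\nu_\theta(\cdot\mid s)=\mathcal N(\pi_\theta(s),\sigma^2 I)$ and let $\rho^{\nu_\theta}=\sum_{t\ge 0}\gamma^t\rho_t$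 be the (unnormalized) discounted state visitation measure, where $\rho_t$ is the law of the state at time $t$ when $s_0\sim\rho_0$ and actions are drawn from $\nu_\theta$. Below, $\mathbb E_{s\sim\rho^{\nu_\theta},\,\tilde a\sim\nu_\theta}[f(s,\tilde a)]$ means $\int_{\mathcal S}\int_{\mathbb R^m} f(s,\tilde a)\,\nu_\theta(d\tilde a\mid s)\,\rho^{\nu_\theta}(ds)$. Fix $\theta$ and suppose that $\theta'\mapsto\pi_{\theta'}(s)$ is differentiable at $\theta$ for every $s$, and that there are a neighbourhood $U$ of $\theta$ and a function $L:\mathcal S\to\mathbb R$, integrable with respect to $\rho^{\nu_\theta}$, such that $\|\pi_{\theta'}(s)-\pi_\theta(s)\|\le L(s)\,\|\theta'-\theta\|$ for all $\theta'\in U$ and $s\in\mathcal S$. (No continuity or differentiability of $R$, $P$ or $Q_\sigma^{\pi_\theta}$ in the action is assumed.) Then $J_\sigma$ is differentiable at $\theta$, both integrands below are integrable, and $$\nabla_\theta J_\sigma=\mathbb E_{s\sim\rho^{\nu_\theta},\,\tilde a\sim\nu_\theta}\Bigl[-\tfrac1{2\sigma^2}\,\nabla_\theta\|\tilde a-\pi_\theta(s)\|_2^2\;Q_\sigma^{\pi_\theta}(s,\tilde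 a)\Bigr]=\mathbb E_{s\sim\rho^{\nu_\theta},\,\tilde a\sim\nu_\theta}\Bigl[\tfrac1{\sigma^2}\,\nabla_\theta\pi_\theta(s)\,(\tilde a-\pi_\theta(s))\,Q_\sigma^{\pi_\theta}(s,\tilde a)\Bigr],$$ where $\nabla_\theta\pi_\theta(s)\in\mathbb R^{d\times m}$ is the transpose of the Jacobian of $\theta\mapsto\pi_\theta(s)$, and in $\nabla_\theta\|\tilde a-\pi_\theta(s)\|_2^2$ the action $\tilde a$ is held fixed. -/

import Mathlib

open MeasureTheory ProbabilityTheory Filter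
open scoped Topology ENNReal Gradient MatrixOrder

namespace SoftDPG

/-- The action space `ℝᵐ` with the Euclidean norm. -/
abbrev Action (m : ℕ) : Type := EuclideanSpace ℝ (Fin m)

/-- A discounted Markov decision process with measurable state space `S`, action space `ℝᵐ`,
transition kernel `P(ds' | s, a)`, bounded measurable reward `R(s, a)`, discount factor
`γ ∈ [0, 1)` and initial state distribution `ρ₀`. -/
structure MDP (S : Type*) [MeasurableSpace S] (m : ℕ) where
  /-- the transition kernel `P(· | s, a)` -/
  P : Kernel (S × Action m) S
  /-- the transition kernel consists of probability measures -/
  isMarkov : IsMarkovKernel P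
  /-- the reward `R(s, a)` -/
  R : S → Action m → ℝ
  /-- the reward is measurable -/
  measurable_R : Measurable (Function.uncurry R)
  /-- the reward is bounded -/
  bounded_R : ∃ Rmax : ℝ, ∀ s a, |R s a| ≤ Rmax
  /-- the discount factor -/
  γ : ℝ
  /-- the discount factor is nonnegative -/
  γ_nonneg : 0 ≤ γ
  /-- the discount factor is less than one -/
  γ_lt_one : γ < 1
  /-- the initial state distribution -/
  ρ₀ : Measure S
  /-- the initial state distribution is a probability measure -/
  isProb : IsProbabilityMeasure ρ₀

attribute [instance] MDP.isMarkov MDP.isProb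

variable {S : Type*} [MeasurableSpace S] {m : ℕ}

/-- `V(s) = 𝔼_{w ∼ N(0, I)} [Q(s, π(s) + σ w)]`. -/
noncomputable def smoothedAverage (σ : ℝ) (π : S → Action m) (Q : S → Action m → ℝ) (s : S) : ℝ :=
  ∫ w, Q s (π s + σ • w) ∂(stdGaussian (Action m))

/-- The `σ`-smoothed Bellman expectation operator
`(T Q)(s, a) = R(s, a) + γ 𝔼_{s' ∼ P(· | s, a), w ∼ N(0, I)} [Q(s', π(s') + σ w)]`. -/
noncomputable def bellmanOp (M : MDP S m) (σ : ℝ) (π : S → Action m) (Q : S → Action m → ℝ) :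
    S → Action m → ℝ :=
  fun s a => M.R s a + M.γ * ∫ s', smoothedAverage σ π Q s' ∂(M.P (s, a))

/-- `Q` is a bounded measurable function on `S × ℝᵐ` which solves the `σ`-smoothed Bellman
equation, i.e. is a fixed point of the `σ`-smoothed Bellman operator. -/
structure IsSmoothedCritic (M : MDP S m) (σ : ℝ) (π : S → Action m) (Q : S → Action m → ℝ) :
    Prop where
  measurable : Measurable (Function.uncurry Q)
  bounded : ∃ C : ℝ, ∀ s a, |Q s a| ≤ C
  fixed : bellmanOp M σ π Q = Q

theorem measurable_smoothedAverage (σ : ℝ) {π : S → Action m} (hπ : Measurable π)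
    {Q : S → Action m → ℝ} (hQ : Measurable (Function.uncurry Q)) :
    Measurable (smoothedAverage σ π Q) := by
  have h : Measurable (fun p : S × Action m => Q p.1 (π p.1 + σ • p.2)) :=
    hQ.comp (measurable_fst.prodMk
      ((hπ.comp measurable_fst).add (measurable_snd.const_smul σ)))
  exact (h.stronglyMeasurable.integral_prod_right' (ν := stdGaussian (Action m))).measurable

theorem abs_smoothedAverage_le {S : Type*} (σ : ℝ) (π : S → Action m) {Q : S → Action m → ℝ} {C : ℝ}
    (hC : ∀ s a, |Q s a| ≤ C) (s : S) : |smoothedAverage σ π Q s| ≤ C := by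
  have h := norm_integral_le_of_norm_le_const (μ := stdGaussian (Action m))
    (f := fun w => Q s (π s + σ • w)) (C := C) (Eventually.of_forall fun w => hC _ _)
  simpa [smoothedAverage] using h

theorem measurable_bellmanOp (M : MDP S m) (σ : ℝ) {π : S → Action m} (hπ : Measurable π)
    {Q : S → Action m → ℝ} (hQ : Measurable (Function.uncurry Q)) :
    Measurable (Function.uncurry (bellmanOp M σ π Q)) := by
  have h : Measurable (fun p : S × Action m => ∫ s', smoothedAverage σ π Q s' ∂(M.P p)) :=
    ((measurable_smoothedAverage σ hπ hQ).stronglyMeasurable.integral_kernel).measurable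
  exact M.measurable_R.add (h.const_mul M.γ)

theorem integrable_of_bounded (μ : Measure S) [IsProbabilityMeasure μ] {f : S → ℝ}
    (hf : Measurable f) {C : ℝ} (hC : ∀ s, |f s| ≤ C) : Integrable f μ :=
  Integrable.of_bound hf.aestronglyMeasurable C (Eventually.of_forall hC)

/-- The smoothed Bellman operator contracts the supremum distance by the factor `γ`. -/
theorem bellmanOp_contraction (M : MDP S m) (σ : ℝ) {π : S → Action m} (hπ : Measurable π)
    {Q Q' : S → Action m → ℝ} (hQ : Measurable (Function.uncurry Q))
    (hQ' : Measurable (Function.uncurry Q')) (bQ : ∃ C : ℝ, ∀ s a, |Q s a| ≤ C)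
    (bQ' : ∃ C : ℝ, ∀ s a, |Q' s a| ≤ C) {d : ℝ} (hd : ∀ s a, |Q s a - Q' s a| ≤ d)
    (s : S) (a : Action m) :
    |bellmanOp M σ π Q s a - bellmanOp M σ π Q' s a| ≤ M.γ * d := by
  obtain ⟨C, hC⟩ := bQ
  obtain ⟨C', hC'⟩ := bQ'
  have hV : ∀ s', |smoothedAverage σ π Q s' - smoothedAverage σ π Q' s'| ≤ d := by
    intro s'
    have e : smoothedAverage σ π Q s' - smoothedAverage σ π Q' s'
        = smoothedAverage σ π (fun s a => Q s a - Q' s a) s' := by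
      have hw : Measurable (fun w : Action m => (s', π s' + σ • w)) := by fun_prop
      refine (integral_sub ?_ ?_).symm
      · exact Integrable.of_bound (hQ.comp hw).aestronglyMeasurable C
          (Eventually.of_forall fun w => hC _ _)
      · exact Integrable.of_bound (hQ'.comp hw).aestronglyMeasurable C'
          (Eventually.of_forall fun w => hC' _ _)
    rw [e]
    exact abs_smoothedAverage_le σ π hd s'
  have e : bellmanOp M σ π Q s a - bellmanOp M σ π Q' s a
      = M.γ * ∫ s', (smoothedAverage σ π Q s' - smoothedAverage σ π Q' s') ∂(M.P (s, a)) := by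
    rw [integral_sub
      (integrable_of_bounded _ (measurable_smoothedAverage σ hπ hQ) (abs_smoothedAverage_le σ π hC))
      (integrable_of_bounded _ (measurable_smoothedAverage σ hπ hQ')
        (abs_smoothedAverage_le σ π hC'))]
    simp only [bellmanOp]
    ring
  rw [e, abs_mul, abs_of_nonneg M.γ_nonneg]
  refine mul_le_mul_of_nonneg_left ?_ M.γ_nonneg
  have h := norm_integral_le_of_norm_le_const (μ := M.P (s, a))
    (f := fun s' => smoothedAverage σ π Q s' - smoothedAverage σ π Q' s') (C := d)
    (Eventually.of_forall hV)
  simpa using h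

/-- The `σ`-smoothed Bellman equation has exactly one bounded measurable solution. -/
theorem existsUnique_isSmoothedCritic (M : MDP S m) (σ : ℝ) {π : S → Action m}
    (hπ : Measurable π) : ∃! Q : S → Action m → ℝ, IsSmoothedCritic M σ π Q := by
  have hγ0 := M.γ_nonneg
  have hγ1 := M.γ_lt_one
  obtain ⟨Rm, hRm⟩ := M.bounded_R
  let q : ℕ → S → Action m → ℝ := fun n => (bellmanOp M σ π)^[n] (fun _ _ => 0)
  have q_succ : ∀ n, q (n + 1) = bellmanOp M σ π (q n) := fun n =>
    Function.iterate_succ_apply' _ _ _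
  have q_meas : ∀ n, Measurable (Function.uncurry (q n)) := by
    intro n
    induction n with
    | zero => exact measurable_const
    | succ n ih => rw [q_succ]; exact measurable_bellmanOp M σ hπ ih
  have op_bdd : ∀ (Q : S → Action m → ℝ) (C : ℝ), (∀ s a, |Q s a| ≤ C) →
      ∀ s a, |bellmanOp M σ π Q s a| ≤ Rm + M.γ * C := by
    intro Q C hC s a
    have h := norm_integral_le_of_norm_le_const (μ := M.P (s, a))
      (f := smoothedAverage σ π Q) (C := C)
      (Eventually.of_forall (abs_smoothedAverage_le σ π hC))
    have h' : |∫ s', smoothedAverage σ π Q s' ∂(M.P (s, a))| ≤ C := by simpa using h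
    refine (abs_add_le _ _).trans (add_le_add (hRm s a) ?_)
    rw [abs_mul, abs_of_nonneg hγ0]
    exact mul_le_mul_of_nonneg_left h' hγ0
  have q_bdd : ∀ n, ∃ C : ℝ, ∀ s a, |q n s a| ≤ C := by
    intro n
    induction n with
    | zero => exact ⟨0, fun s a => by simp [q]⟩
    | succ n ih =>
      obtain ⟨C, hC⟩ := ih
      exact ⟨Rm + M.γ * C, by rw [q_succ]; exact op_bdd _ C hC⟩
  have q_step : ∀ n s a, |q n s a - q (n + 1) s a| ≤ Rm * M.γ ^ n := by
    intro n
    induction n with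
    | zero =>
      intro s a
      have : q 1 s a = M.R s a := by simp [q, bellmanOp, smoothedAverage]
      have h0 : q 0 s a = 0 := rfl
      simpa [this, h0] using hRm s a
    | succ n ih =>
      intro s a
      have h := bellmanOp_contraction M σ hπ (q_meas n) (q_meas (n + 1)) (q_bdd n) (q_bdd (n + 1))
        ih s a
      rw [← q_succ, ← q_succ] at h
      calc _ ≤ _ := h
        _ = _ := by ring
  have q_lim : ∀ s a, ∃ l : ℝ, Tendsto (fun n => q n s a) atTop (𝓝 l) := fun s a =>
    cauchySeq_tendsto_of_complete
      (cauchySeq_of_le_geometric M.γ Rm hγ1 fun n => by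
        rw [Real.dist_eq]; exact q_step n s a)
  choose Q hQ using q_lim
  have hQd : ∀ n s a, |q n s a - Q s a| ≤ Rm * M.γ ^ n / (1 - M.γ) := by
    intro n s a
    have h := dist_le_of_le_geometric_of_tendsto M.γ Rm hγ1 (f := fun n => q n s a)
      (fun n => by rw [Real.dist_eq]; exact q_step n s a) (hQ s a) n
    rwa [Real.dist_eq] at h
  have Q_meas : Measurable (Function.uncurry Q) :=
    measurable_of_tendsto_metrizable q_meas (tendsto_pi_nhds.2 fun p => hQ p.1 p.2)
  have Q_bdd : ∃ C : ℝ, ∀ s a, |Q s a| ≤ C :=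
    ⟨Rm * M.γ ^ 0 / (1 - M.γ), fun s a => by
      have h := hQd 0 s a
      have h0 : q 0 s a = 0 := rfl
      rwa [h0, zero_sub, abs_neg] at h⟩
  have Q_fix : bellmanOp M σ π Q = Q := by
    funext s a
    refine tendsto_nhds_unique (f := fun n => q (n + 1) s a) (l := atTop) ?_
      ((tendsto_add_atTop_iff_nat 1).2 (hQ s a))
    rw [tendsto_iff_dist_tendsto_zero]
    have h0 : Tendsto (fun n => M.γ * (Rm * M.γ ^ n / (1 - M.γ))) atTop (𝓝 0) := by
      have := tendsto_pow_atTop_nhds_zero_of_lt_one hγ0 hγ1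
      simpa using ((this.const_mul Rm).div_const (1 - M.γ)).const_mul M.γ
    refine squeeze_zero (fun _ => dist_nonneg) (fun n => ?_) h0
    rw [Real.dist_eq, q_succ]
    exact bellmanOp_contraction M σ hπ (q_meas n) Q_meas (q_bdd n) Q_bdd (hQd n) s a
  refine ⟨Q, ⟨Q_meas, Q_bdd, Q_fix⟩, fun Q' hQ' => ?_⟩
  obtain ⟨C, hC⟩ := Q_bdd
  obtain ⟨C', hC'⟩ := hQ'.bounded
  have hd : ∀ n : ℕ, ∀ s a, |Q' s a - Q s a| ≤ M.γ ^ n * (C' + C) := by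
    intro n
    induction n with
    | zero =>
      intro s a
      simpa using (abs_sub _ _).trans (add_le_add (hC' s a) (hC s a))
    | succ n ih =>
      intro s a
      have h := bellmanOp_contraction M σ hπ hQ'.measurable Q_meas hQ'.bounded ⟨C, hC⟩ ih s a
      rw [hQ'.fixed, Q_fix] at h
      calc _ ≤ _ := h
        _ = _ := by ring
  funext s a
  have h0 : Tendsto (fun n : ℕ => M.γ ^ n * (C' + C)) atTop (𝓝 0) := by
    simpa using (tendsto_pow_atTop_nhds_zero_of_lt_one hγ0 hγ1).mul_const (C' + C)
  have h1 : |Q' s a - Q s a| ≤ 0 := ge_of_tendsto' h0 fun n => hd n s a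
  exact sub_eq_zero.1 (abs_nonpos_iff.1 h1)

/-- The smoothed critic `Q_σ^π`: the unique bounded measurable fixed point of the `σ`-smoothed
Bellman operator. -/
noncomputable def smoothedCritic (M : MDP S m) (σ : ℝ) (π : S → Action m) (hπ : Measurable π) :
    S → Action m → ℝ :=
  (existsUnique_isSmoothedCritic M σ hπ).choose

theorem isSmoothedCritic_smoothedCritic (M : MDP S m) (σ : ℝ) (π : S → Action m)
    (hπ : Measurable π) : IsSmoothedCritic M σ π (smoothedCritic M σ π hπ) :=
  (existsUnique_isSmoothedCritic M σ hπ).choose_spec.1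

/-- The smoothed value function `V_σ^π(s) = 𝔼_{w ∼ N(0, I)} [Q_σ^π(s, π(s) + σ w)]`. -/
noncomputable def smoothedValue (M : MDP S m) (σ : ℝ) (π : S → Action m) (hπ : Measurable π) :
    S → ℝ :=
  smoothedAverage σ π (smoothedCritic M σ π hπ)

/-- The smoothed objective `J_σ = 𝔼_{s₀ ∼ ρ₀} [V_σ^π(s₀)]`. -/
noncomputable def smoothedObjective (M : MDP S m) (σ : ℝ) (π : S → Action m)
    (hπ : Measurable π) : ℝ :=
  ∫ s, smoothedValue M σ π hπ s ∂M.ρ₀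

/-- The Gaussian policy `ν(· | s) = N(π(s), σ² I)`, as a kernel from states to actions. -/
noncomputable def gaussianPolicy (σ : ℝ) (π : S → Action m) (hπ : Measurable π) :
    Kernel S (Action m) where
  toFun s := multivariateGaussian (π s) (σ ^ 2 • (1 : Matrix (Fin m) (Fin m) ℝ))
  measurable' := by
    refine Measure.measurable_of_measurable_coe _ fun t ht => ?_
    simp only [multivariateGaussian]
    generalize CFC.sqrt (σ ^ 2 • (1 : Matrix (Fin m) (Fin m) ℝ)) = B
    have h : Measurable (fun p : S × Action m =>
        π p.1 + Matrix.toEuclideanCLM (𝕜 := ℝ) B p.2) :=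
      (hπ.comp measurable_fst).add (by fun_prop)
    have h' := measurable_measure_prodMk_left (ν := stdGaussian (Action m)) (h ht)
    convert h' using 2 with s
    rw [Measure.map_apply (by fun_prop) ht]
    rfl

instance (σ : ℝ) (π : S → Action m) (hπ : Measurable π) :
    IsMarkovKernel (gaussianPolicy σ π hπ) :=
  ⟨fun s => inferInstanceAs (IsProbabilityMeasure
    (multivariateGaussian (π s) (σ ^ 2 • (1 : Matrix (Fin m) (Fin m) ℝ))))⟩

/-- `ν(· | s)` is the law of the smoothed action `π(s) + σ w`, `w ∼ N(0, I)`. -/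
theorem gaussianPolicy_apply {σ : ℝ} (hσ : 0 ≤ σ) (π : S → Action m) (hπ : Measurable π) (s : S) :
    gaussianPolicy σ π hπ s = (stdGaussian (Action m)).map (fun w => π s + σ • w) := by
  have h : CFC.sqrt (σ ^ 2 • (1 : Matrix (Fin m) (Fin m) ℝ)) = σ • 1 := by
    rw [CFC.sqrt_eq_iff _ _ (Matrix.PosSemidef.one.smul (by positivity)).nonneg
      (Matrix.PosSemidef.one.smul hσ).nonneg]
    simp [pow_two, smul_smul]
  change multivariateGaussian _ _ = _
  rw [multivariateGaussian, h]
  simp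

/-- One step of the state process when actions are drawn from `ν`: from `s`, draw `a ∼ ν(· | s)`
and then `s' ∼ P(· | s, a)`. -/
noncomputable def stateKernel (M : MDP S m) (ν : Kernel S (Action m)) : Kernel S S :=
  M.P ∘ₖ (Kernel.id ×ₖ ν)

/-- The law `ρ_t` of the state at time `t`, when `s₀ ∼ ρ₀` and actions are drawn from `ν`. -/
noncomputable def stateLaw (M : MDP S m) (ν : Kernel S (Action m)) : ℕ → Measure S
  | 0 => M.ρ₀
  | t + 1 => stateKernel M ν ∘ₘ stateLaw M ν t

/-- The (unnormalized) discounted state visitation measure `ρ^ν = ∑ₜ γᵗ ρ_t`. -/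
noncomputable def visitation (M : MDP S m) (ν : Kernel S (Action m)) : Measure S :=
  Measure.sum fun t => ENNReal.ofReal M.γ ^ t • stateLaw M ν t

instance (M : MDP S m) (ν : Kernel S (Action m)) [IsMarkovKernel ν] :
    IsMarkovKernel (stateKernel M ν) := by
  unfold stateKernel; infer_instance

instance (M : MDP S m) (ν : Kernel S (Action m)) [IsMarkovKernel ν] (t : ℕ) :
    IsProbabilityMeasure (stateLaw M ν t) := by
  induction t with
  | zero => exact M.isProb
  | succ t ih => unfold stateLaw; infer_instance

/-- The visitation measure is finite; its total mass is `1 / (1 - γ)`. -/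
instance (M : MDP S m) (ν : Kernel S (Action m)) [IsMarkovKernel ν] :
    IsFiniteMeasure (visitation M ν) := by
  refine ⟨?_⟩
  have h : ENNReal.ofReal M.γ < 1 := by simpa using M.γ_lt_one
  simp only [visitation, Measure.sum_apply _ MeasurableSet.univ, Measure.smul_apply, measure_univ,
    smul_eq_mul, mul_one, ENNReal.tsum_geometric]
  simpa using h

end SoftDPG

namespace SoftDPG

/-! ### Translation of Gaussian measures -/

/-! The visitation measure of $\pi_\theta$ can be kept fixed. The performance difference identity
(`integral_smoothedAverage_sub`) writes $J_\sigma(\theta')-J_\sigma(\theta)$ as the integral over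
$\rho^{\nu_\theta}$ of the change in the Gaussian average of one and the same critic
$Q_\sigma^{\pi_{\theta'}}$ when the mean moves from $\pi_\theta(s)$ to $\pi_{\theta'}(s)$. Neither
the visitation measure nor the critic is ever differentiated.

Such a change of mean is a translation of the Gaussian, and the Cameron–Martin density moves it off
the critic (`stdGaussian_map_add`). Hence a bounded measurable critic suffices. The density is
$1+\langle u,w\rangle+O(\|u\|^2)$ in $L^1$, and its linear term yields the score factor $(\tilde
a-\pi_\theta(s))/\sigma^2$.

The critic still depends on $\theta'$, but it is bounded uniformly (`IsSmoothedCritic.abs_le`) and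
converges pointwise to $Q_\sigma^{\pi_\theta}$ (`tendsto_critic`). This gives the expansion at each
state (`isLittleO_integral_shift`). The $L^1$ Lipschitz bound on the density, combined with $L$,
dominates the difference quotients, so the limit passes under $\rho^{\nu_\theta}$. -/

theorem gaussianReal_eq_withDensity (u : ℝ) :
    gaussianReal u 1 = (gaussianReal 0 1).withDensity
      (fun x => ENNReal.ofReal (Real.exp (u * x - u ^ 2 / 2))) := by
  rw [gaussianReal_of_var_ne_zero _ one_ne_zero, gaussianReal_of_var_ne_zero _ one_ne_zero,
    ← withDensity_mul _ (measurable_gaussianPDF 0 1) (by fun_prop)]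
  congr 1
  funext x
  rw [Pi.mul_apply, gaussianPDF_def, gaussianPDF_def,
    ← ENNReal.ofReal_mul (gaussianPDFReal_nonneg 0 1 x), gaussianPDFReal_def, gaussianPDFReal_def]
  simp only [mul_assoc, ← Real.exp_add]
  congr 3
  push_cast
  ring

theorem lintegral_pi_prod {ι : Type*} [Fintype ι] (μ : ι → Measure ℝ)
    [∀ i, IsProbabilityMeasure (μ i)] {f : ι → ℝ → ℝ≥0∞} (hf : ∀ i, Measurable (f i)) :
    ∫⁻ x, ∏ i, f i (x i) ∂(Measure.pi μ) = ∏ i, ∫⁻ y, f i y ∂(μ i) := by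
  have hind : iIndepFun (fun i (x : ι → ℝ) => f i (x i)) (Measure.pi μ) :=
    iIndepFun_pi fun i => (hf i).aemeasurable
  have h := lintegral_prod_eq_prod_lintegral_of_indepFun Finset.univ
    (fun i (x : ι → ℝ) => f i (x i)) hind (fun i => (hf i).comp (measurable_pi_apply i))
  rw [h]
  refine Finset.prod_congr rfl fun i _ => ?_
  rw [← (measurePreserving_eval μ i).lintegral_comp (hf i)]

/-- On a box, the indicator times the product density is again a product of one-variable functions,
and boxes determine the product measure. -/
theorem pi_withDensity {ι : Type*} [Fintype ι] (μ : ι → Measure ℝ)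
    [∀ i, IsProbabilityMeasure (μ i)] {f : ι → ℝ → ℝ≥0∞} (hf : ∀ i, Measurable (f i))
    [∀ i, SigmaFinite ((μ i).withDensity (f i))] :
    Measure.pi (fun i => (μ i).withDensity (f i))
      = (Measure.pi μ).withDensity (fun x => ∏ i, f i (x i)) := by
  refine Measure.pi_eq fun s hs => ?_
  rw [withDensity_apply _ (MeasurableSet.univ_pi hs),
    ← lintegral_indicator (MeasurableSet.univ_pi hs)]
  have e : (Set.univ.pi s).indicator (fun x : ι → ℝ => ∏ i, f i (x i))
      = fun x => ∏ i, (s i).indicator (f i) (x i) := by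
    classical
    funext x
    by_cases hx : x ∈ Set.univ.pi s
    · rw [Set.indicator_of_mem hx]
      exact Finset.prod_congr rfl fun i _ =>
        (Set.indicator_of_mem (hx i (Set.mem_univ i)) _).symm
    · rw [Set.indicator_of_notMem hx]
      simp only [Set.mem_pi, Set.mem_univ, true_implies, not_forall] at hx
      obtain ⟨i, hi⟩ := hx
      exact (Finset.prod_eq_zero (Finset.mem_univ i) (Set.indicator_of_notMem hi _)).symm
  rw [e, lintegral_pi_prod μ fun i => (hf i).indicator (hs i)]
  exact Finset.prod_congr rfl fun i _ => by
    rw [lintegral_indicator (hs i), withDensity_apply _ (hs i)]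

/-- The Cameron–Martin density of the standard Gaussian measure translated by `u`. -/
noncomputable def shiftDensity {m : ℕ} (u w : Action m) : ℝ :=
  Real.exp (inner ℝ u w - ‖u‖ ^ 2 / 2)

variable {m : ℕ}

theorem measurable_shiftDensity (u : Action m) : Measurable (shiftDensity u) := by
  unfold shiftDensity; fun_prop

/-- The coordinates are independent, so the one-dimensional densities multiply and their exponents
add up to $\langle u,w\rangle-\|u\|^2/2$. -/
theorem stdGaussian_map_add (u : Action m) :
    (stdGaussian (Action m)).map (fun w => u + w)
      = (stdGaussian (Action m)).withDensity (fun w => ENNReal.ofReal (shiftDensity u w)) := by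
  have hpi : (Measure.pi fun _ : Fin m => gaussianReal 0 1).map (fun x i => u i + x i)
      = (Measure.pi fun _ : Fin m => gaussianReal 0 1).withDensity
        (fun x => ENNReal.ofReal (shiftDensity u (WithLp.toLp 2 x))) := by
    have h1 := Measure.pi_map_pi (μ := fun _ : Fin m => gaussianReal 0 1)
      (f := fun i x => u i + x) (fun i => by fun_prop)
    rw [h1]
    simp only [gaussianReal_map_const_add, zero_add]
    have : ∀ i, SigmaFinite ((gaussianReal 0 1).withDensity
        (fun x => ENNReal.ofReal (Real.exp (u i * x - u i ^ 2 / 2)))) := fun i => by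
      rw [← gaussianReal_eq_withDensity]; infer_instance
    have h2 := pi_withDensity (fun _ : Fin m => gaussianReal 0 1)
      (f := fun i x => ENNReal.ofReal (Real.exp (u i * x - u i ^ 2 / 2))) (fun i => by fun_prop)
    simp only [gaussianReal_eq_withDensity (u _)]
    rw [h2]
    congr 1
    funext x
    rw [← ENNReal.ofReal_prod_of_nonneg fun i _ => (Real.exp_pos _).le, ← Real.exp_sum,
      shiftDensity, EuclideanSpace.norm_sq_eq, Finset.sum_sub_distrib, ← Finset.sum_div]
    simp [PiLp.inner_apply, mul_comm]
  rw [← map_pi_eq_stdGaussian, Measure.map_map (by fun_prop) (by fun_prop)]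
  have e : (fun w : Action m => u + w) ∘ WithLp.toLp 2
      = WithLp.toLp 2 ∘ fun (x : Fin m → ℝ) i => u i + x i := by
    funext x; ext i; simp
  rw [e, ← Measure.map_map (by fun_prop) (by fun_prop), hpi]
  ext s hs
  rw [Measure.map_apply (by fun_prop) hs, withDensity_apply _ (by measurability),
    withDensity_apply _ hs, setLIntegral_map hs
      ((measurable_shiftDensity u).ennreal_ofReal) (by fun_prop)]

theorem integral_stdGaussian_add (u : Action m) (f : Action m → ℝ) (hf : Measurable f) :
    ∫ w, f (u + w) ∂(stdGaussian (Action m))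
      = ∫ w, shiftDensity u w * f w ∂(stdGaussian (Action m)) := by
  rw [← integral_map (φ := fun w => u + w) (by fun_prop) hf.aestronglyMeasurable,
    stdGaussian_map_add, integral_withDensity_eq_integral_toReal_smul
      (measurable_shiftDensity u).ennreal_ofReal (by simp)]
  simp [shiftDensity, ENNReal.toReal_ofReal (Real.exp_pos _).le]

theorem integrable_shiftDensity (u : Action m) :
    Integrable (shiftDensity u) (stdGaussian (Action m)) := by
  -- A non-integrable density would have Bochner integral $0$, whereas translating the constant $1$
  -- gives $1$.
  by_contra h
  have h1 := integral_stdGaussian_add u (fun _ => 1) measurable_const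
  simp [integral_undef h] at h1

theorem integral_shiftDensity (u : Action m) :
    ∫ w, shiftDensity u w ∂(stdGaussian (Action m)) = 1 := by
  have h1 := integral_stdGaussian_add u (fun _ => 1) measurable_const
  simpa using h1.symm

/-! ### $L^1$ estimates for the shift density. -/

theorem integrable_norm_stdGaussian :
    Integrable (fun w : Action m => ‖w‖) (stdGaussian (Action m)) :=
  (IsGaussian.integrable_id (μ := stdGaussian (Action m))).norm

/-- Reduces functions of $\langle u,w\rangle$ to one real Gaussian variable, so that the remainder
estimate does not depend on the dimension. -/
theorem map_inner_stdGaussian (u : Action m) :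
    (stdGaussian (Action m)).map (fun w => inner ℝ u w)
      = (gaussianReal 0 1).map (fun x => ‖u‖ * x) := by
  have h := IsGaussian.map_eq_gaussianReal (μ := stdGaussian (Action m)) (innerSL ℝ u)
  rw [integral_strongDual_stdGaussian, variance_dual_stdGaussian, innerSL_apply_norm] at h
  rw [gaussianReal_map_const_mul]
  simp only [mul_zero, mul_one]
  convert h using 2
  · ext w; simp
  exact (Real.toNNReal_of_nonneg (sq_nonneg ‖u‖)).symm

/-- A Gaussian-integrable majorant of the second order remainder of the shift density. -/
noncomputable def remainderMajorant (x : ℝ) : ℝ :=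
  2 * Real.exp 2 * (Real.exp (2 * x) + Real.exp (-2 * x)) + 1

theorem integrable_remainderMajorant : Integrable remainderMajorant (gaussianReal 0 1) :=
  (((integrable_exp_mul_gaussianReal 2).add (integrable_exp_mul_gaussianReal (-2))).const_mul
    (2 * Real.exp 2)).add (integrable_const 1)

theorem abs_exp_sub_one_sub_le (y : ℝ) : |Real.exp y - 1 - y| ≤ y ^ 2 * Real.exp |y| := by
  have h := Complex.norm_exp_sub_sum_le_norm_mul_exp (y : ℂ) 2
  have e : Complex.exp y - ∑ k ∈ Finset.range 2, (y : ℂ) ^ k / k.factorial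
      = ((Real.exp y - 1 - y : ℝ) : ℂ) := by
    simp [Finset.sum_range_succ, sub_sub]
  rwa [e, Complex.norm_real, Complex.norm_real, Real.norm_eq_abs, Real.norm_eq_abs, sq_abs] at h

/-- Taylor's bound is applied at $y=rx-r^2/2$, where $r\le 1$ gives $|y|\le r(|x|+1)$. The
polynomial factor is absorbed by $t^2\le 2e^t$. The gap $r^2/2$ between $y$ and $rx$ goes into the
`+ 1` of the majorant. -/
theorem remainder_le {r : ℝ} (h0 : 0 ≤ r) (h1 : r ≤ 1) (x : ℝ) :
    |Real.exp (r * x - r ^ 2 / 2) - 1 - r * x| ≤ r ^ 2 * remainderMajorant x := by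
  have hy : |r * x - r ^ 2 / 2| ≤ r * (|x| + 1) := by
    refine (abs_sub _ _).trans ?_
    rw [abs_mul, abs_of_nonneg h0, abs_of_nonneg (by positivity : (0:ℝ) ≤ r ^ 2 / 2)]
    nlinarith
  have hy' : |r * x - r ^ 2 / 2| ≤ |x| + 1 := hy.trans (by nlinarith [abs_nonneg x])
  have e1 : |Real.exp (r * x - r ^ 2 / 2) - 1 - r * x|
      ≤ |Real.exp (r * x - r ^ 2 / 2) - 1 - (r * x - r ^ 2 / 2)| + r ^ 2 / 2 := by
    have := abs_sub (Real.exp (r * x - r ^ 2 / 2) - 1 - (r * x - r ^ 2 / 2)) (r ^ 2 / 2)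
    rw [abs_of_nonneg (by positivity : (0:ℝ) ≤ r ^ 2 / 2)] at this
    rwa [show Real.exp (r * x - r ^ 2 / 2) - 1 - (r * x - r ^ 2 / 2) - r ^ 2 / 2
      = Real.exp (r * x - r ^ 2 / 2) - 1 - r * x by ring] at this
  have e2 : (r * x - r ^ 2 / 2) ^ 2 * Real.exp |r * x - r ^ 2 / 2|
      ≤ (r * (|x| + 1)) ^ 2 * Real.exp (|x| + 1) := by
    refine mul_le_mul ?_ (Real.exp_le_exp.2 hy') (Real.exp_pos _).le (by positivity)
    rw [← sq_abs]
    exact pow_le_pow_left₀ (abs_nonneg _) hy 2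
  have e3 : (|x| + 1) ^ 2 ≤ 2 * Real.exp (|x| + 1) := by
    have := Real.quadratic_le_exp_of_nonneg (by positivity : 0 ≤ |x| + 1)
    nlinarith [abs_nonneg x]
  have e4 : Real.exp (|x| + 1) * Real.exp (|x| + 1)
      ≤ Real.exp 2 * (Real.exp (2 * x) + Real.exp (-2 * x)) := by
    rw [← Real.exp_add, show |x| + 1 + (|x| + 1) = 2 + 2 * |x| by ring, Real.exp_add]
    refine mul_le_mul_of_nonneg_left ?_ (Real.exp_pos _).le
    rcases abs_cases x with ⟨h, -⟩ | ⟨h, -⟩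
    · rw [h]; linarith [Real.exp_pos (-2 * x)]
    · rw [h, show 2 * -x = -2 * x by ring]; linarith [Real.exp_pos (2 * x)]
  have e5 : (|x| + 1) ^ 2 * Real.exp (|x| + 1)
      ≤ 2 * Real.exp 2 * (Real.exp (2 * x) + Real.exp (-2 * x)) := by
    calc _ ≤ 2 * Real.exp (|x| + 1) * Real.exp (|x| + 1) :=
          mul_le_mul_of_nonneg_right e3 (Real.exp_pos _).le
      _ ≤ _ := by nlinarith
  calc _ ≤ _ := e1
    _ ≤ (r * (|x| + 1)) ^ 2 * Real.exp (|x| + 1) + r ^ 2 / 2 := by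
        gcongr
        exact (abs_exp_sub_one_sub_le _).trans e2
    _ = r ^ 2 * ((|x| + 1) ^ 2 * Real.exp (|x| + 1) + 1 / 2) := by ring
    _ ≤ _ := by
        refine mul_le_mul_of_nonneg_left ?_ (sq_nonneg r)
        unfold remainderMajorant
        linarith

theorem integrable_inner_stdGaussian (u : Action m) :
    Integrable (fun w => inner ℝ u w) (stdGaussian (Action m)) :=
  (IsGaussian.integrable_id (μ := stdGaussian (Action m))).const_inner u

theorem integral_abs_remainder_le {u : Action m} (hu : ‖u‖ ≤ 1) :
    ∫ w, |shiftDensity u w - 1 - inner ℝ u w| ∂(stdGaussian (Action m))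
      ≤ ‖u‖ ^ 2 * ∫ x, remainderMajorant x ∂(gaussianReal 0 1) := by
  have e : ∫ w, |shiftDensity u w - 1 - inner ℝ u w| ∂(stdGaussian (Action m))
      = ∫ x, |Real.exp (‖u‖ * x - ‖u‖ ^ 2 / 2) - 1 - ‖u‖ * x| ∂(gaussianReal 0 1) := by
    have hg : Measurable fun y : ℝ => |Real.exp (y - ‖u‖ ^ 2 / 2) - 1 - y| := by fun_prop
    have h1 := integral_map (μ := stdGaussian (Action m)) (φ := fun w => inner ℝ u w)
      (by fun_prop) hg.aestronglyMeasurable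
    have h2 := integral_map (μ := gaussianReal 0 1) (φ := fun x => ‖u‖ * x)
      (by fun_prop) hg.aestronglyMeasurable
    rw [map_inner_stdGaussian, h2] at h1
    exact h1.symm
  rw [e, ← integral_const_mul]
  exact integral_mono_of_nonneg (Eventually.of_forall fun x => abs_nonneg _)
    (integrable_remainderMajorant.const_mul _)
    (Eventually.of_forall fun x => remainder_le (norm_nonneg u) hu x)

/-- The `L¹` distance between the standard Gaussian density and its translate by `u` is at most
linear in `‖u‖`. -/
theorem exists_integral_abs_shiftDensity_sub_one_le (m : ℕ) :
    ∃ K : ℝ, 0 ≤ K ∧ ∀ u : Action m,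
      ∫ w, |shiftDensity u w - 1| ∂(stdGaussian (Action m)) ≤ K * ‖u‖ := by
  set A := ∫ x, remainderMajorant x ∂(gaussianReal 0 1)
  set B := ∫ w : Action m, ‖w‖ ∂(stdGaussian (Action m))
  have hA : 0 ≤ A := integral_nonneg fun x => by unfold remainderMajorant; positivity
  have hB : 0 ≤ B := integral_nonneg fun x => norm_nonneg x
  -- For $\|u\|\le 1$ the quadratic remainder costs $A$ and the linear term $B$. For $\|u\|\ge 1$
  -- the trivial bound $2\le 2\|u\|$ is enough.
  refine ⟨A + B + 2, by positivity, fun u => ?_⟩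
  have i1 : Integrable (fun w => shiftDensity u w - 1) (stdGaussian (Action m)) :=
    (integrable_shiftDensity u).sub (integrable_const 1)
  have hu := norm_nonneg u
  rcases le_total ‖u‖ 1 with h | h
  · have h1 : ∫ w, |shiftDensity u w - 1| ∂(stdGaussian (Action m))
        ≤ ∫ w, (|shiftDensity u w - 1 - inner ℝ u w| + ‖u‖ * ‖w‖) ∂(stdGaussian (Action m)) := by
      refine integral_mono i1.abs ((i1.sub (integrable_inner_stdGaussian u)).abs.add
        (integrable_norm_stdGaussian.const_mul _)) fun w => ?_
      have := abs_add_le (shiftDensity u w - 1 - inner ℝ u w) (inner ℝ u w)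
      rw [sub_add_cancel] at this
      exact this.trans (add_le_add le_rfl (abs_real_inner_le_norm u w))
    rw [integral_add (f := fun w => |shiftDensity u w - 1 - inner ℝ u w|)
      (i1.sub (integrable_inner_stdGaussian u)).abs (integrable_norm_stdGaussian.const_mul _),
      integral_const_mul] at h1
    have h2 := integral_abs_remainder_le h
    have h3 : ‖u‖ ^ 2 * A ≤ ‖u‖ * A := mul_le_mul_of_nonneg_right (by nlinarith) hA
    change _ ≤ _ + ‖u‖ * B at h1
    change _ ≤ ‖u‖ ^ 2 * A at h2
    linarith
  · have h1 : ∫ w, |shiftDensity u w - 1| ∂(stdGaussian (Action m))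
        ≤ ∫ w, (shiftDensity u w + 1) ∂(stdGaussian (Action m)) := by
      refine integral_mono i1.abs ((integrable_shiftDensity u).add (integrable_const 1))
        fun w => ?_
      have h0 : 0 < shiftDensity u w := Real.exp_pos _
      exact abs_le.2 ⟨by linarith, by linarith⟩
    rw [integral_add (integrable_shiftDensity u) (integrable_const 1), integral_shiftDensity] at h1
    simp only [integral_const, probReal_univ, smul_eq_mul, mul_one] at h1
    nlinarith

variable {S : Type*} [MeasurableSpace S]

/-! ### The performance difference identity -/

/-- Iterating the Bellman equation replaces the a priori bound, which may depend on the policy, by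
one that does not. This uniformity feeds every domination argument below. -/
theorem IsSmoothedCritic.abs_le {M : MDP S m} {σ : ℝ} {π : S → Action m} {Q : S → Action m → ℝ}
    (hQ : IsSmoothedCritic M σ π Q) {Rm : ℝ} (hR : ∀ s a, |M.R s a| ≤ Rm) (s : S) (a : Action m) :
    |Q s a| ≤ Rm / (1 - M.γ) := by
  have hγ0 := M.γ_nonneg
  have hγ1 : 0 < 1 - M.γ := sub_pos.2 M.γ_lt_one
  obtain ⟨B, hB⟩ := hQ.bounded
  have key : ∀ n : ℕ, ∀ s a, |Q s a| ≤ Rm / (1 - M.γ) + M.γ ^ n * (B - Rm / (1 - M.γ)) := by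
    intro n
    induction n with
    | zero => intro s a; simpa using hB s a
    | succ n ih =>
      intro s a
      have h := norm_integral_le_of_norm_le_const (μ := M.P (s, a))
        (f := smoothedAverage σ π Q) (Eventually.of_forall (abs_smoothedAverage_le σ π ih))
      rw [probReal_univ, mul_one, Real.norm_eq_abs] at h
      have e : Q s a = M.R s a + M.γ * ∫ s', smoothedAverage σ π Q s' ∂(M.P (s, a)) :=
        (congrFun (congrFun hQ.fixed s) a).symm
      have hs : Rm + M.γ * (Rm / (1 - M.γ)) = Rm / (1 - M.γ) := by field_simp; ring
      rw [e]
      calc _ ≤ |M.R s a| + |M.γ * ∫ s', smoothedAverage σ π Q s' ∂(M.P (s, a))| := abs_add_le _ _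
        _ ≤ Rm + M.γ * (Rm / (1 - M.γ) + M.γ ^ n * (B - Rm / (1 - M.γ))) := by
            rw [abs_mul, abs_of_nonneg hγ0]
            exact add_le_add (hR s a) (mul_le_mul_of_nonneg_left h hγ0)
        _ = (Rm + M.γ * (Rm / (1 - M.γ))) + M.γ ^ (n + 1) * (B - Rm / (1 - M.γ)) := by ring
        _ = _ := by rw [hs]
  have h0 : Tendsto (fun n : ℕ => Rm / (1 - M.γ) + M.γ ^ n * (B - Rm / (1 - M.γ))) atTop
      (𝓝 (Rm / (1 - M.γ) + 0 * (B - Rm / (1 - M.γ)))) :=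
    ((tendsto_pow_atTop_nhds_zero_of_lt_one hγ0 M.γ_lt_one).mul_const _).const_add _
  rw [zero_mul, add_zero] at h0
  exact ge_of_tendsto' h0 fun n => key n s a

theorem integral_gaussianPolicy {E : Type*} [NormedAddCommGroup E] [NormedSpace ℝ E] {σ : ℝ}
    (hσ : 0 ≤ σ) {π : S → Action m} (hπ : Measurable π) {f : Action m → E}
    (hf : StronglyMeasurable f) (s : S) :
    ∫ a, f a ∂(gaussianPolicy σ π hπ s) = ∫ w, f (π s + σ • w) ∂(stdGaussian (Action m)) := by
  rw [gaussianPolicy_apply hσ, integral_map (by fun_prop) hf.aestronglyMeasurable]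

theorem integral_stateKernel (M : MDP S m) (ν : Kernel S (Action m)) [IsMarkovKernel ν]
    {D : S → ℝ} (hD : Measurable D) {C : ℝ} (hC : ∀ s, |D s| ≤ C) (s : S) :
    ∫ s', D s' ∂(stateKernel M ν s) = ∫ a, ∫ s', D s' ∂(M.P (s, a)) ∂(ν s) := by
  have hi : Integrable D ((M.P ∘ₖ (Kernel.id ×ₖ ν)) s) := integrable_of_bounded _ hD hC
  rw [stateKernel, Kernel.integral_comp hi, Kernel.prod_apply, Kernel.id_apply,
    Measure.dirac_prod, integral_map (by fun_prop)]
  exact (hD.stronglyMeasurable.integral_kernel).aestronglyMeasurable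

theorem integral_stateLaw_succ (M : MDP S m) (ν : Kernel S (Action m)) [IsMarkovKernel ν]
    {D : S → ℝ} (hD : Measurable D) {C : ℝ} (hC : ∀ s, |D s| ≤ C) (t : ℕ) :
    ∫ s, D s ∂(stateLaw M ν (t + 1))
      = ∫ s, ∫ s', D s' ∂(stateKernel M ν s) ∂(stateLaw M ν t) := by
  have hi : Integrable (fun p : S × S => D p.2) (stateLaw M ν t ⊗ₘ stateKernel M ν) :=
    integrable_of_bounded _ (hD.comp measurable_snd) fun p => hC p.2
  rw [stateLaw, ← Measure.snd_compProd, Measure.snd, integral_map (by fun_prop)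
    hD.aestronglyMeasurable, Measure.integral_compProd hi]

theorem hasSum_integral_visitation (M : MDP S m) (ν : Kernel S (Action m)) [IsMarkovKernel ν]
    {D : S → ℝ} (hD : Integrable D (visitation M ν)) :
    HasSum (fun t => M.γ ^ t * ∫ s, D s ∂(stateLaw M ν t)) (∫ s, D s ∂(visitation M ν)) := by
  have h := hasSum_integral_measure (μ := fun t => ENNReal.ofReal M.γ ^ t • stateLaw M ν t) hD
  simp only [integral_smul_measure, ENNReal.toReal_pow, ENNReal.toReal_ofReal M.γ_nonneg,
    smul_eq_mul] at h
  exact h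

/-- The visitation measure satisfies $\rho=\rho_0+\gamma\rho K$ for the state kernel $K$, so the two
discounted series telescope. -/
theorem integral_visitation_sub (M : MDP S m) (ν : Kernel S (Action m)) [IsMarkovKernel ν]
    {D : S → ℝ} (hD : Measurable D) {C : ℝ} (hC : ∀ s, |D s| ≤ C) :
    ∫ s, (D s - M.γ * ∫ s', D s' ∂(stateKernel M ν s)) ∂(visitation M ν) = ∫ s, D s ∂M.ρ₀ := by
  have hK : Measurable fun s => ∫ s', D s' ∂(stateKernel M ν s) :=
    (hD.stronglyMeasurable.integral_kernel).measurable
  have hKC : ∀ s, |∫ s', D s' ∂(stateKernel M ν s)| ≤ C := fun s => by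
    have h := norm_integral_le_of_norm_le_const (μ := stateKernel M ν s) (f := D)
      (Eventually.of_forall hC)
    simpa using h
  have iD : Integrable D (visitation M ν) :=
    Integrable.of_bound hD.aestronglyMeasurable C (Eventually.of_forall hC)
  have iK : Integrable (fun s => ∫ s', D s' ∂(stateKernel M ν s)) (visitation M ν) :=
    Integrable.of_bound hK.aestronglyMeasurable C (Eventually.of_forall hKC)
  have h1 := hasSum_integral_visitation M ν iD
  have h2 := (hasSum_integral_visitation M ν iK).mul_left M.γ
  rw [integral_sub iD (iK.const_mul _), integral_const_mul]
  -- Without its term at $t=0$, the series for `D` is the series `h2` for $\gamma KD$. That missing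
  -- term is the integral over $\rho_0$.
  have h3 := (hasSum_nat_add_iff' 1).2 h1
  have e : (fun t => M.γ * (M.γ ^ t * ∫ s, ∫ s', D s' ∂(stateKernel M ν s) ∂(stateLaw M ν t)))
      = fun t => M.γ ^ (t + 1) * ∫ s, D s ∂(stateLaw M ν (t + 1)) := by
    funext t
    rw [integral_stateLaw_succ M ν hD hC]
    ring
  rw [e] at h2
  have h4 := h3.unique h2
  simp only [Finset.range_one, Finset.sum_singleton, pow_zero, one_mul] at h4
  rw [← h4]
  simp [stateLaw]

theorem critic_sub_eq {M : MDP S m} {σ : ℝ} {π π' : S → Action m}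
    (hπ : Measurable π) (hπ' : Measurable π') {Q Q' : S → Action m → ℝ}
    (hQ : IsSmoothedCritic M σ π Q) (hQ' : IsSmoothedCritic M σ π' Q') (s : S) (a : Action m) :
    Q' s a - Q s a
      = M.γ * ∫ s', (smoothedAverage σ π' Q' s' - smoothedAverage σ π Q s') ∂(M.P (s, a)) := by
  obtain ⟨C, hC⟩ := hQ.bounded
  obtain ⟨C', hC'⟩ := hQ'.bounded
  rw [integral_sub
    (integrable_of_bounded _ (measurable_smoothedAverage σ hπ' hQ'.measurable)
      (abs_smoothedAverage_le σ π' hC'))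
    (integrable_of_bounded _ (measurable_smoothedAverage σ hπ hQ.measurable)
      (abs_smoothedAverage_le σ π hC))]
  have e : Q s a = M.R s a + M.γ * ∫ s', smoothedAverage σ π Q s' ∂(M.P (s, a)) :=
    (congrFun (congrFun hQ.fixed s) a).symm
  have e' : Q' s a = M.R s a + M.γ * ∫ s', smoothedAverage σ π' Q' s' ∂(M.P (s, a)) :=
    (congrFun (congrFun hQ'.fixed s) a).symm
  rw [e, e']
  ring

/-- The performance difference identity: the gap between two smoothed objectives is the expected
gap of the two smoothed averages of the second critic along the first policy. -/
theorem integral_smoothedAverage_sub {M : MDP S m} {σ : ℝ} (hσ : 0 ≤ σ) {π π' : S → Action m}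
    (hπ : Measurable π) (hπ' : Measurable π') {Q Q' : S → Action m → ℝ}
    (hQ : IsSmoothedCritic M σ π Q) (hQ' : IsSmoothedCritic M σ π' Q') :
    ∫ s, (smoothedAverage σ π' Q' s - smoothedAverage σ π Q s) ∂M.ρ₀
      = ∫ s, (smoothedAverage σ π' Q' s - smoothedAverage σ π Q' s)
          ∂(visitation M (gaussianPolicy σ π hπ)) := by
  obtain ⟨C, hC⟩ := hQ.bounded
  obtain ⟨C', hC'⟩ := hQ'.bounded
  have hD : Measurable fun s => smoothedAverage σ π' Q' s - smoothedAverage σ π Q s :=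
    (measurable_smoothedAverage σ hπ' hQ'.measurable).sub
      (measurable_smoothedAverage σ hπ hQ.measurable)
  have hDC : ∀ s, |smoothedAverage σ π' Q' s - smoothedAverage σ π Q s| ≤ C' + C := fun s =>
    (abs_sub _ _).trans
      (add_le_add (abs_smoothedAverage_le σ π' hC' s) (abs_smoothedAverage_le σ π hC s))
  rw [← integral_visitation_sub M (gaussianPolicy σ π hπ) hD hDC]
  refine integral_congr_ae (Eventually.of_forall fun s => ?_)
  have hm : ∀ {F : S → Action m → ℝ}, Measurable (Function.uncurry F) → Measurable (F s) :=
    fun hF => hF.comp measurable_prodMk_left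
  -- Averaging the critic difference over $\nu(\cdot\mid s)$ produces one step of the state process.
  -- In $D-\gamma KD$ the average of `Q` then cancels and only `Q'` remains.
  have e : smoothedAverage σ π Q' s - smoothedAverage σ π Q s
      = M.γ * ∫ s', (smoothedAverage σ π' Q' s' - smoothedAverage σ π Q s')
        ∂(stateKernel M (gaussianPolicy σ π hπ) s) := by
    rw [integral_stateKernel M _ hD hDC, ← integral_const_mul]
    simp only [← critic_sub_eq hπ hπ' hQ hQ']
    rw [integral_sub (integrable_of_bounded _ (hm hQ'.measurable) (hC' s))
      (integrable_of_bounded _ (hm hQ.measurable) (hC s)),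
      integral_gaussianPolicy hσ hπ (hm hQ'.measurable).stronglyMeasurable,
      integral_gaussianPolicy hσ hπ (hm hQ.measurable).stronglyMeasurable]
    rfl
  change smoothedAverage σ π' Q' s - smoothedAverage σ π Q s - M.γ * _ = _
  rw [← e]
  ring

/-! ### Shifts of the policy mean -/

/-- Expresses a change of mean as a shift of the noise by $\sigma^{-1}(\pi'(s)-\pi(s))$, the form to
which the shift density applies. -/
theorem smoothedAverage_eq_integral_add {S : Type*} {σ : ℝ} (hσ : σ ≠ 0) (π π' : S → Action m)
    (Q : S → Action m → ℝ) (s : S) :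
    smoothedAverage σ π' Q s
      = ∫ w, Q s (π s + σ • (σ⁻¹ • (π' s - π s) + w)) ∂(stdGaussian (Action m)) := by
  unfold smoothedAverage
  congr 1
  funext w
  rw [smul_add, smul_inv_smul₀ hσ, ← add_assoc, add_sub_cancel]

theorem integral_shift_sub {f : Action m → ℝ} (hf : Measurable f) {C : ℝ} (hC : ∀ w, |f w| ≤ C)
    (u : Action m) :
    ∫ w, f (u + w) ∂(stdGaussian (Action m)) - ∫ w, f w ∂(stdGaussian (Action m))
      = ∫ w, (shiftDensity u w - 1) * f w ∂(stdGaussian (Action m)) := by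
  have i1 : Integrable (fun w => shiftDensity u w * f w) (stdGaussian (Action m)) :=
    (integrable_shiftDensity u).mul_bdd hf.aestronglyMeasurable (Eventually.of_forall hC)
  rw [integral_stdGaussian_add u f hf, ← integral_sub i1 (integrable_of_bounded _ hf hC)]
  simp only [sub_mul, one_mul]

theorem abs_integral_mul_le {X : Type*} [MeasurableSpace X] {μ : Measure X} {g f : X → ℝ}
    (hg : Integrable g μ) {C : ℝ} (hC : ∀ w, |f w| ≤ C) :
    |∫ w, g w * f w ∂μ| ≤ C * ∫ w, |g w| ∂μ := by
  rw [← integral_const_mul, ← Real.norm_eq_abs]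
  refine norm_integral_le_of_norm_le (hg.abs.const_mul C) (Eventually.of_forall fun w => ?_)
  rw [norm_mul, mul_comm, Real.norm_eq_abs, Real.norm_eq_abs]
  exact mul_le_mul_of_nonneg_right (hC w) (abs_nonneg _)

theorem abs_integral_shift_sub_le {K : ℝ}
    (hK : ∀ u : Action m, ∫ w, |shiftDensity u w - 1| ∂(stdGaussian (Action m)) ≤ K * ‖u‖)
    {f : Action m → ℝ} (hf : Measurable f) {C : ℝ} (hC : ∀ w, |f w| ≤ C) (u : Action m) :
    |∫ w, f (u + w) ∂(stdGaussian (Action m)) - ∫ w, f w ∂(stdGaussian (Action m))|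
      ≤ C * (K * ‖u‖) := by
  rw [integral_shift_sub hf hC]
  exact (abs_integral_mul_le ((integrable_shiftDensity u).sub (integrable_const 1)) hC).trans
    (mul_le_mul_of_nonneg_left (hK u) ((abs_nonneg _).trans (hC 0)))

/-- The smoothing makes the average Lipschitz in the mean although `Q` may be discontinuous in the
action. `K` bounds the density change and $\sigma^{-1}$ rescales the shift. -/
theorem abs_smoothedAverage_sub_le {σ : ℝ} (hσ : 0 < σ) {K : ℝ}
    (hK : ∀ u : Action m, ∫ w, |shiftDensity u w - 1| ∂(stdGaussian (Action m)) ≤ K * ‖u‖)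
    (π π' : S → Action m) {Q : S → Action m → ℝ} (hQ : Measurable (Function.uncurry Q)) {C : ℝ}
    (hC : ∀ s a, |Q s a| ≤ C) (s : S) :
    |smoothedAverage σ π' Q s - smoothedAverage σ π Q s|
      ≤ C * K * σ⁻¹ * ‖π' s - π s‖ := by
  have hf : Measurable fun w => Q s (π s + σ • w) := by
    have : Measurable fun w : Action m => (s, π s + σ • w) := by fun_prop
    exact hQ.comp this
  have h := abs_integral_shift_sub_le hK hf (fun w => hC s _) (σ⁻¹ • (π' s - π s))
  rw [smoothedAverage_eq_integral_add hσ.ne' π π', smoothedAverage]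
  refine h.trans (le_of_eq ?_)
  rw [norm_smul, norm_inv, Real.norm_of_nonneg hσ.le]
  ring

/-! ### Pointwise continuity of the critic in the policy parameter -/

theorem tendsto_smoothedAverage {E : Type*} {l : Filter E} [l.IsCountablyGenerated] {M : MDP S m}
    {σ : ℝ} (hσ : 0 < σ) {π : S → Action m} {π' : E → S → Action m} (hπ : Measurable π)
    (hπ' : ∀ y, Measurable (π' y)) {Q : S → Action m → ℝ} {Q' : E → S → Action m → ℝ}
    (hQ : IsSmoothedCritic M σ π Q) (hQ' : ∀ y, IsSmoothedCritic M σ (π' y) (Q' y))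
    (hlim : ∀ s, Tendsto (fun y => π' y s) l (𝓝 (π s))) (s : S) :
    Tendsto (fun y => smoothedAverage σ (π' y) (Q' y) s) l (𝓝 (smoothedAverage σ π Q s)) := by
  obtain ⟨K, hK0, hK⟩ := exists_integral_abs_shiftDensity_sub_one_le m
  obtain ⟨Rm, hRm⟩ := M.bounded_R
  have hC := fun y => (hQ' y).abs_le hRm
  set C := Rm / (1 - M.γ)
  -- The critic does not depend on the initial distribution, so the performance difference identity
  -- may be started from a Dirac mass at `s`, which turns it into a pointwise statement.
  let Ms : MDP S m := { M with ρ₀ := Measure.dirac s, isProb := Measure.dirac.isProbabilityMeasure }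
  have hQs : IsSmoothedCritic Ms σ π Q := ⟨hQ.measurable, hQ.bounded, hQ.fixed⟩
  have hQs' : ∀ y, IsSmoothedCritic Ms σ (π' y) (Q' y) := fun y =>
    ⟨(hQ' y).measurable, (hQ' y).bounded, (hQ' y).fixed⟩
  have e : ∀ y, smoothedAverage σ (π' y) (Q' y) s - smoothedAverage σ π Q s
      = ∫ s, (smoothedAverage σ (π' y) (Q' y) s - smoothedAverage σ π (Q' y) s)
          ∂(visitation Ms (gaussianPolicy σ π hπ)) := fun y => by
    rw [← integral_smoothedAverage_sub hσ.le hπ (hπ' y) hQs (hQs' y)]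
    exact (integral_dirac' _ _ ((measurable_smoothedAverage σ (hπ' y) (hQ' y).measurable).sub
      (measurable_smoothedAverage σ hπ hQ.measurable)).stronglyMeasurable).symm
  rw [← tendsto_sub_nhds_zero_iff]
  simp only [e]
  rw [← integral_zero S ℝ (μ := visitation Ms (gaussianPolicy σ π hπ))]
  refine tendsto_integral_filter_of_dominated_convergence (fun _ => C + C)
    (Eventually.of_forall fun y => ((measurable_smoothedAverage σ (hπ' y) (hQ' y).measurable).sub
      (measurable_smoothedAverage σ hπ (hQ' y).measurable)).aestronglyMeasurable)
    (Eventually.of_forall fun y => Eventually.of_forall fun s => (abs_sub _ _).trans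
      (add_le_add (abs_smoothedAverage_le σ _ (hC y) s) (abs_smoothedAverage_le σ _ (hC y) s)))
    (integrable_const _) (Eventually.of_forall fun s' => ?_)
  have h0 : Tendsto (fun y => C * K * σ⁻¹ * ‖π' y s' - π s'‖) l (𝓝 0) := by
    have := (tendsto_sub_nhds_zero_iff.2 (hlim s')).norm.const_mul (C * K * σ⁻¹)
    simpa using this
  exact squeeze_zero_norm
    (fun y => abs_smoothedAverage_sub_le hσ hK π (π' y) (hQ' y).measurable (hC y) s') h0

theorem tendsto_critic {E : Type*} {l : Filter E} [l.IsCountablyGenerated] {M : MDP S m}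
    {σ : ℝ} (hσ : 0 < σ) {π : S → Action m} {π' : E → S → Action m} (hπ : Measurable π)
    (hπ' : ∀ y, Measurable (π' y)) {Q : S → Action m → ℝ} {Q' : E → S → Action m → ℝ}
    (hQ : IsSmoothedCritic M σ π Q) (hQ' : ∀ y, IsSmoothedCritic M σ (π' y) (Q' y))
    (hlim : ∀ s, Tendsto (fun y => π' y s) l (𝓝 (π s))) (s : S) (a : Action m) :
    Tendsto (fun y => Q' y s a) l (𝓝 (Q s a)) := by
  obtain ⟨Rm, hRm⟩ := M.bounded_R
  have hC := fun y => (hQ' y).abs_le hRm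
  have e : Q s a = M.R s a + M.γ * ∫ s', smoothedAverage σ π Q s' ∂(M.P (s, a)) :=
    (congrFun (congrFun hQ.fixed s) a).symm
  have e' : ∀ y, Q' y s a
      = M.R s a + M.γ * ∫ s', smoothedAverage σ (π' y) (Q' y) s' ∂(M.P (s, a)) := fun y =>
    (congrFun (congrFun (hQ' y).fixed s) a).symm
  simp only [e, e']
  refine (Tendsto.const_mul _ ?_).const_add _
  exact tendsto_integral_filter_of_dominated_convergence (fun _ => Rm / (1 - M.γ))
    (Eventually.of_forall fun y =>
      (measurable_smoothedAverage σ (hπ' y) (hQ' y).measurable).aestronglyMeasurable)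
    (Eventually.of_forall fun y => Eventually.of_forall (abs_smoothedAverage_le σ _ (hC y)))
    (integrable_const _)
    (Eventually.of_forall (tendsto_smoothedAverage hσ hπ hπ' hQ hQ' hlim))

/-! ### Differentiating a Gaussian average in its shift -/

/-- The error splits into three: `o1` is the second-order remainder of the density, of size
$\|u\|^2$; `o2` is the linear term against `f y - f x`, where $\|u\|$ multiplies an integral that
vanishes by dominated convergence; `o3` is the nonlinearity of `u`. Pointwise convergence of `f y`
is enough because the prefactor in `o2` is already of first order. -/
theorem isLittleO_integral_shift {E : Type*} [NormedAddCommGroup E] [NormedSpace ℝ E] {x : E}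
    {u : E → Action m} {u' : E →L[ℝ] Action m} (hu : HasFDerivAt u u' x) (hux : u x = 0)
    {f : E → Action m → ℝ} (hf : ∀ y, Measurable (f y)) {C : ℝ} (hC : ∀ y w, |f y w| ≤ C)
    (hlim : ∀ w, Tendsto (fun y => f y w) (𝓝 x) (𝓝 (f x w))) :
    (fun y => ∫ w, f y (u y + w) ∂(stdGaussian (Action m)) - ∫ w, f y w ∂(stdGaussian (Action m))
      - ∫ w, inner ℝ (u' (y - x)) w * f x w ∂(stdGaussian (Action m)))
      =o[𝓝 x] fun y => y - x := by
  have hu0 : Tendsto u (𝓝 x) (𝓝 0) := hux ▸ hu.continuousAt.tendsto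
  have huO : u =O[𝓝 x] fun y => y - x := by simpa [hux] using hu.isBigO_sub
  have hC0 : 0 ≤ C := (abs_nonneg _).trans (hC x 0)
  have ib : ∀ {g : Action m → ℝ}, Integrable g (stdGaussian (Action m)) → ∀ y,
      Integrable (fun w => g w * f y w) (stdGaussian (Action m)) := fun hg y =>
    hg.mul_bdd (hf y).aestronglyMeasurable (Eventually.of_forall (hC y))
  have ii := fun v : Action m => integrable_inner_stdGaussian v
  have ir : ∀ v : Action m, Integrable (fun w => shiftDensity v w - 1) (stdGaussian (Action m)) :=
    fun v => (integrable_shiftDensity v).sub (integrable_const 1)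
  have irr : ∀ v : Action m,
      Integrable (fun w => shiftDensity v w - 1 - inner ℝ v w) (stdGaussian (Action m)) :=
    fun v => (ir v).sub (ii v)
  have ifn : ∀ y, Integrable (fun w => ‖w‖ * (f y w - f x w)) (stdGaussian (Action m)) := by
    intro y
    simp only [mul_sub]
    exact (ib integrable_norm_stdGaussian y).sub (ib integrable_norm_stdGaussian x)
  have o1 : (fun y => ∫ w, (shiftDensity (u y) w - 1 - inner ℝ (u y) w) * f y w
      ∂(stdGaussian (Action m))) =o[𝓝 x] fun y => y - x := by
    refine Asymptotics.IsLittleO.trans_isBigO (g := u) ?_ huO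
    have hO : (fun y => ∫ w, (shiftDensity (u y) w - 1 - inner ℝ (u y) w) * f y w
        ∂(stdGaussian (Action m))) =O[𝓝 x] fun y => ‖u y‖ ^ 2 := by
      refine Asymptotics.IsBigO.of_bound (C * ∫ x, remainderMajorant x ∂(gaussianReal 0 1)) ?_
      have h1 : ∀ᶠ y in 𝓝 x, ‖u y‖ < 1 := by
        simpa using hu0.norm.eventually (gt_mem_nhds (by simp : ‖(0 : Action m)‖ < 1))
      filter_upwards [h1] with y hy
      refine (abs_integral_mul_le (irr (u y)) (hC y)).trans ?_
      refine (mul_le_mul_of_nonneg_left (integral_abs_remainder_le hy.le) hC0).trans (le_of_eq ?_)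
      rw [Real.norm_of_nonneg (by positivity)]
      ring
    refine hO.trans_isLittleO ?_
    have := ((Asymptotics.isLittleO_one_iff ℝ).2
      (tendsto_zero_iff_norm_tendsto_zero.1 hu0)).mul_isBigO
      (Asymptotics.isBigO_refl (fun y => ‖u y‖) (𝓝 x))
    simp only [one_mul, ← pow_two] at this
    exact this.of_norm_right
  have o2 : (fun y => ∫ w, inner ℝ (u y) w * (f y w - f x w) ∂(stdGaussian (Action m)))
      =o[𝓝 x] fun y => y - x := by
    have hδ : Tendsto (fun y => ∫ w, ‖w‖ * |f y w - f x w| ∂(stdGaussian (Action m)))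
        (𝓝 x) (𝓝 0) := by
      rw [← integral_zero (Action m) ℝ (μ := stdGaussian (Action m))]
      refine tendsto_integral_filter_of_dominated_convergence (fun w => ‖w‖ * (C + C))
        (Eventually.of_forall fun y => ?_)
        (Eventually.of_forall fun y => Eventually.of_forall fun w => ?_)
        (integrable_norm_stdGaussian.mul_const _) (Eventually.of_forall fun w => ?_)
      · exact (measurable_norm.mul ((hf y).sub (hf x)).abs).aestronglyMeasurable
      · rw [Real.norm_of_nonneg (by positivity)]
        exact mul_le_mul_of_nonneg_left
          ((abs_sub _ _).trans (add_le_add (hC y w) (hC x w))) (norm_nonneg w)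
      · have := (tendsto_sub_nhds_zero_iff.2 (hlim w)).abs.const_mul ‖w‖
        simpa using this
    have hO : (fun y => ∫ w, inner ℝ (u y) w * (f y w - f x w) ∂(stdGaussian (Action m)))
        =O[𝓝 x] fun y => (∫ w, ‖w‖ * |f y w - f x w| ∂(stdGaussian (Action m))) * ‖u y‖ := by
      refine Asymptotics.IsBigO.of_bound 1 (Eventually.of_forall fun y => ?_)
      rw [one_mul, Real.norm_of_nonneg (mul_nonneg (integral_nonneg fun w => by positivity)
        (norm_nonneg _)), ← integral_mul_const]
      have hi : Integrable (fun w => ‖w‖ * |f y w - f x w|) (stdGaussian (Action m)) := by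
        simpa [abs_mul] using (ifn y).abs
      refine norm_integral_le_of_norm_le (hi.mul_const _) (Eventually.of_forall fun w => ?_)
      rw [norm_mul, Real.norm_eq_abs, Real.norm_eq_abs]
      calc _ ≤ (‖u y‖ * ‖w‖) * |f y w - f x w| :=
            mul_le_mul_of_nonneg_right (abs_real_inner_le_norm _ _) (abs_nonneg _)
        _ = _ := by ring
    refine hO.trans_isLittleO ?_
    have := ((Asymptotics.isLittleO_one_iff ℝ).2 hδ).mul_isBigO huO.norm_norm
    simpa using this
  have o3 : (fun y => ∫ w, inner ℝ (u y - u' (y - x)) w * f x w ∂(stdGaussian (Action m)))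
      =o[𝓝 x] fun y => y - x := by
    have h := hu.isLittleO
    simp only [hux, sub_zero] at h
    refine Asymptotics.IsBigO.trans_isLittleO (Asymptotics.IsBigO.of_bound
      (C * ∫ w : Action m, ‖w‖ ∂(stdGaussian (Action m))) (Eventually.of_forall fun y => ?_)) h
    refine (abs_integral_mul_le (ii _) (hC x)).trans ?_
    rw [mul_assoc]
    refine mul_le_mul_of_nonneg_left ?_ hC0
    rw [← integral_mul_const]
    refine integral_mono (ii _).abs (integrable_norm_stdGaussian.mul_const _) fun w => ?_
    rw [mul_comm]
    exact abs_real_inner_le_norm _ _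
  refine ((o1.add o2).add o3).congr_left fun y => ?_
  have i2 : Integrable (fun w => inner ℝ (u y) w * (f y w - f x w)) (stdGaussian (Action m)) := by
    simp only [mul_sub]
    exact (ib (ii (u y)) y).sub (ib (ii (u y)) x)
  rw [integral_shift_sub (hf y) (hC y), ← integral_add (ib (irr (u y)) y) i2,
    ← integral_add (f := fun w => (shiftDensity (u y) w - 1 - inner ℝ (u y) w) * f y w
      + inner ℝ (u y) w * (f y w - f x w)) ((ib (irr (u y)) y).add i2) (ib (ii _) x),
    ← integral_sub (ib (ir (u y)) y) (ib (ii _) x)]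
  congr 1
  funext w
  simp only [inner_sub_left]
  ring

/-! ### The policy gradient integrands -/

/-- A directional derivative is the pointwise limit of the difference quotients with step $1/n$,
which are measurable in `s`. -/
theorem measurable_fderiv_apply {d : ℕ} {π : EuclideanSpace ℝ (Fin d) → S → Action m}
    (hπ : ∀ θ, Measurable (π θ)) {θ : EuclideanSpace ℝ (Fin d)}
    (hdiff : ∀ s, DifferentiableAt ℝ (fun θ' => π θ' s) θ) (v : EuclideanSpace ℝ (Fin d)) :
    Measurable fun s => fderiv ℝ (fun θ' => π θ' s) θ v := by
  refine measurable_of_tendsto_metrizable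
    (f := fun (n : ℕ) s => (n : ℝ) • (π (θ + (n : ℝ)⁻¹ • v) s - π θ s))
    (fun n => by fun_prop) (tendsto_pi_nhds.2 fun s => ?_)
  exact ((hdiff s).hasFDerivAt.lim_real v).comp tendsto_natCast_atTop_atTop

theorem measurable_adjoint_fderiv_apply {d : ℕ} {π : EuclideanSpace ℝ (Fin d) → S → Action m}
    (hπ : ∀ θ, Measurable (π θ)) {θ : EuclideanSpace ℝ (Fin d)}
    (hdiff : ∀ s, DifferentiableAt ℝ (fun θ' => π θ' s) θ) :
    Measurable fun p : S × Action m =>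
      ContinuousLinearMap.adjoint (fderiv ℝ (fun θ' => π θ' p.1) θ) (p.2 - π θ p.1) := by
  -- Expanding in an orthonormal basis moves the adjoint to the other side of the inner product and
  -- leaves only directional derivatives.
  have e : (fun p : S × Action m =>
      ContinuousLinearMap.adjoint (fderiv ℝ (fun θ' => π θ' p.1) θ) (p.2 - π θ p.1))
      = fun p => ∑ i, inner ℝ (fderiv ℝ (fun θ' => π θ' p.1) θ (EuclideanSpace.basisFun (Fin d) ℝ i))
        (p.2 - π θ p.1) • EuclideanSpace.basisFun (Fin d) ℝ i := by
    funext p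
    rw [← (EuclideanSpace.basisFun (Fin d) ℝ).sum_repr' (ContinuousLinearMap.adjoint _ _)]
    simp only [ContinuousLinearMap.adjoint_inner_right]
  rw [e]
  refine Finset.measurable_sum _ fun i _ => Measurable.smul_const ?_ _
  exact ((measurable_fderiv_apply hπ hdiff _).comp measurable_fst).inner
    (measurable_snd.sub ((hπ θ).comp measurable_fst))

theorem gradient_norm_sub_sq {d : ℕ} {g : EuclideanSpace ℝ (Fin d) → Action m}
    {θ : EuclideanSpace ℝ (Fin d)} (hg : DifferentiableAt ℝ g θ) (a : Action m) :
    gradient (fun θ' => ‖a - g θ'‖ ^ 2) θ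
      = (-2 : ℝ) • ContinuousLinearMap.adjoint (fderiv ℝ g θ) (a - g θ) := by
  have h := (hg.hasFDerivAt.const_sub a).norm_sq
  refine HasGradientAt.gradient (hasGradientAt_iff_hasFDerivAt.2 (h.congr_fderiv ?_))
  refine DFunLike.ext _ _ fun v => ?_
  simp only [InnerProductSpace.toDual_apply_apply, inner_smul_left,
    ContinuousLinearMap.adjoint_inner_left, RCLike.conj_to_real, smul_apply,
    ContinuousLinearMap.comp_apply, neg_apply, innerSL_apply_apply,
    inner_neg_right, nsmul_eq_mul]
  push_cast
  ring

theorem integrable_gradient_integrand {d : ℕ} {σ : ℝ} (hσ : 0 < σ)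
    {π : EuclideanSpace ℝ (Fin d) → S → Action m} (hπ : ∀ θ, Measurable (π θ))
    {θ : EuclideanSpace ℝ (Fin d)} (hdiff : ∀ s, DifferentiableAt ℝ (fun θ' => π θ' s) θ)
    {μ : Measure S} [SFinite μ] {L : S → ℝ} (hL : Integrable L μ)
    (hLip : ∀ s, ‖fderiv ℝ (fun θ' => π θ' s) θ‖ ≤ |L s|)
    {Q : S → Action m → ℝ} (hQ : Measurable (Function.uncurry Q)) {C : ℝ}
    (hC : ∀ s a, |Q s a| ≤ C) :
    Integrable (fun p : S × Action m => (1 / σ ^ 2) • Q p.1 p.2 •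
        ContinuousLinearMap.adjoint (fderiv ℝ (fun θ' => π θ' p.1) θ) (p.2 - π θ p.1))
      (μ ⊗ₘ gaussianPolicy σ (π θ) (hπ θ)) := by
  have hA := measurable_adjoint_fderiv_apply hπ hdiff
  -- Given `s`, the mean of $\|a-\pi_\theta(s)\|$ is $\sigma\,\mathbb E\|w\|$, the same for all
  -- states, so integrability of `L` alone controls the product.
  have hb : Integrable (fun p : S × Action m => C * (L p.1 * ‖p.2 - π θ p.1‖))
      (μ ⊗ₘ gaussianPolicy σ (π θ) (hπ θ)) := by
    refine Integrable.const_mul ?_ C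
    have hn : Measurable fun p : S × Action m => ‖p.2 - π θ p.1‖ :=
      (measurable_snd.sub ((hπ θ).comp measurable_fst)).norm
    have hm : AEStronglyMeasurable (fun p : S × Action m => L p.1 * ‖p.2 - π θ p.1‖)
        (μ ⊗ₘ gaussianPolicy σ (π θ) (hπ θ)) :=
      (hL.aestronglyMeasurable.comp_quasiMeasurePreserving
        ⟨measurable_fst, by
          rw [← Measure.fst, Measure.fst_compProd]⟩).mul hn.aestronglyMeasurable
    have hns : ∀ s, StronglyMeasurable fun a : Action m => ‖a - π θ s‖ := fun s => by fun_prop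
    rw [Measure.integrable_compProd_iff hm]
    constructor
    · refine Eventually.of_forall fun s => ?_
      suffices h : Integrable (fun a : Action m => ‖a - π θ s‖) (gaussianPolicy σ (π θ) (hπ θ) s)
        from h.const_mul (L s)
      rw [gaussianPolicy_apply hσ.le, integrable_map_measure (hns s).aestronglyMeasurable
        (by fun_prop)]
      simpa [Function.comp_def, norm_smul] using integrable_norm_stdGaussian.const_mul |σ|
    · simp only [norm_mul, norm_norm, integral_const_mul]
      refine (hL.norm.mul_const (σ * ∫ w : Action m, ‖w‖ ∂(stdGaussian (Action m)))).congr
        (Eventually.of_forall fun s => ?_)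
      simp only
      rw [integral_gaussianPolicy hσ.le (hπ θ) (hns s)]
      simp [norm_smul, integral_const_mul, abs_of_pos hσ]
  refine Integrable.smul (1 / σ ^ 2) (hb.mono ((hQ.smul hA).aestronglyMeasurable)
    (Eventually.of_forall fun p => ?_))
  rw [Pi.smul_apply', Function.uncurry_def, norm_smul, norm_mul, norm_mul, norm_norm,
    Real.norm_eq_abs, Real.norm_eq_abs, Real.norm_eq_abs]
  refine mul_le_mul ((hC _ _).trans (le_abs_self C)) ?_ (norm_nonneg _) (abs_nonneg _)
  refine (ContinuousLinearMap.le_opNorm _ _).trans (mul_le_mul_of_nonneg_right ?_ (norm_nonneg _))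
  rw [LinearIsometryEquiv.norm_map]
  exact hLip p.1

/-- Under $a=\pi_\theta(s)+\sigma w$ the factor $\sigma^{-2}(a-\pi_\theta(s))$ becomes
$\sigma^{-1}w$. This is the linear term of `isLittleO_integral_shift` for the shift
$\sigma^{-1}(\pi_y(s)-\pi_\theta(s))$. -/
theorem inner_policyGradient_eq {S : Type*} [MeasurableSpace S] {m d : ℕ} {σ : ℝ} (hσ : 0 < σ)
    {π : EuclideanSpace ℝ (Fin d) → S → Action m} (hπ : ∀ θ, Measurable (π θ))
    (θ v : EuclideanSpace ℝ (Fin d)) {Q : S → Action m → ℝ}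
    (hQ : Measurable (Function.uncurry Q)) (s : S)
    (hi : Integrable (fun a => (1 / σ ^ 2) • Q s a •
      ContinuousLinearMap.adjoint (fderiv ℝ (fun θ' => π θ' s) θ) (a - π θ s))
      (gaussianPolicy σ (π θ) (hπ θ) s)) :
    inner ℝ (∫ a, (1 / σ ^ 2) • Q s a •
      ContinuousLinearMap.adjoint (fderiv ℝ (fun θ' => π θ' s) θ) (a - π θ s)
        ∂(gaussianPolicy σ (π θ) (hπ θ) s)) v
      = ∫ w, inner ℝ ((σ⁻¹ • fderiv ℝ (fun θ' => π θ' s) θ) v) w * Q s (π θ s + σ • w)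
          ∂(stdGaussian (Action m)) := by
  have hQs : Measurable (Q s) := hQ.comp measurable_prodMk_left
  rw [real_inner_comm, ← integral_inner hi, integral_gaussianPolicy hσ.le]
  · congr 1
    funext w
    simp only [add_sub_cancel_left, inner_smul_right, ContinuousLinearMap.adjoint_inner_right,
      map_smul, smul_apply, inner_smul_left, RCLike.conj_to_real]
    field_simp
  · refine Measurable.stronglyMeasurable ?_
    fun_prop

end SoftDPG

/-! ### Assembly of the policy gradient theorem. -/

open SoftDPG in
/-- Soft deterministic policy gradient theorem. -/
theorem mainTheorem1 {S : Type*} [MeasurableSpace S] {m d : ℕ} (M : MDP S m) (σ : ℝ) (hσ : 0 < σ)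
    (π : EuclideanSpace ℝ (Fin d) → S → Action m) (hπ : ∀ θ, Measurable (π θ))
    (θ : EuclideanSpace ℝ (Fin d))
    (hdiff : ∀ s, DifferentiableAt ℝ (fun θ' => π θ' s) θ)
    (L : S → ℝ) (hL : Integrable L (visitation M (gaussianPolicy σ (π θ) (hπ θ))))
    (hLip : ∀ᶠ θ' in 𝓝 θ, ∀ s, ‖π θ' s - π θ s‖ ≤ L s * ‖θ' - θ‖) :
    let ν : Kernel S (Action m) := gaussianPolicy σ (π θ) (hπ θ)
    let Q : S → Action m → ℝ := smoothedCritic M σ (π θ) (hπ θ)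
    let μ : Measure (S × Action m) := visitation M ν ⊗ₘ ν
    let G₁ : S × Action m → EuclideanSpace ℝ (Fin d) := fun p =>
      (-(1 / (2 * σ ^ 2))) • Q p.1 p.2 • gradient (fun θ' => ‖p.2 - π θ' p.1‖ ^ 2) θ
    let G₂ : S × Action m → EuclideanSpace ℝ (Fin d) := fun p =>
      (1 / σ ^ 2) • Q p.1 p.2 •
        ContinuousLinearMap.adjoint (fderiv ℝ (fun θ' => π θ' p.1) θ) (p.2 - π θ p.1)
    Integrable G₁ μ ∧ Integrable G₂ μ ∧
      HasGradientAt (fun θ' => smoothedObjective M σ (π θ') (hπ θ')) (∫ p, G₁ p ∂μ) θ ∧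
      HasGradientAt (fun θ' => smoothedObjective M σ (π θ') (hπ θ')) (∫ p, G₂ p ∂μ) θ := by
  intro ν Q μ G₁ G₂
  have hG : G₁ = G₂ := by
    funext p
    simp only [G₁, G₂]
    rw [gradient_norm_sub_sq (hdiff p.1) p.2]
    simp only [smul_smul]
    congr 1
    field_simp
  obtain ⟨K, hK0, hK⟩ := exists_integral_abs_shiftDensity_sub_one_le m
  obtain ⟨Rm, hRm⟩ := M.bounded_R
  have hcrit : ∀ y, IsSmoothedCritic M σ (π y) (smoothedCritic M σ (π y) (hπ y)) := fun y =>
    isSmoothedCritic_smoothedCritic M σ (π y) (hπ y)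
  have hC := fun y => (hcrit y).abs_le hRm
  set C := Rm / (1 - M.γ)
  -- For $d=0$ the Lipschitz bound does not force $L\ge 0$, hence the absolute value.
  have hLip' : ∀ᶠ y in 𝓝 θ, ∀ s, ‖π y s - π θ s‖ ≤ |L s| * ‖y - θ‖ := by
    filter_upwards [hLip] with y hy s
    exact (hy s).trans (mul_le_mul_of_nonneg_right (le_abs_self _) (norm_nonneg _))
  have hfd : ∀ s, ‖fderiv ℝ (fun θ' => π θ' s) θ‖ ≤ |L s| := fun s =>
    (hdiff s).hasFDerivAt.le_of_lip' (abs_nonneg _) (hLip'.mono fun y hy => hy s)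
  have hG₂ : Integrable G₂ μ :=
    integrable_gradient_integrand hσ hπ hdiff hL hfd (hcrit θ).measurable (hC θ)
  suffices h : HasGradientAt (fun θ' => smoothedObjective M σ (π θ') (hπ θ')) (∫ p, G₂ p ∂μ) θ by
    rw [hG]
    exact ⟨hG₂, hG₂, h, h⟩
  have hQlim := tendsto_critic (l := 𝓝 θ) hσ (hπ θ) hπ (hcrit θ) hcrit
    fun s => (hdiff s).continuousAt.tendsto
  set g : S → EuclideanSpace ℝ (Fin d) := fun s => ∫ a, G₂ (s, a) ∂(ν s)
  have hg : Integrable g (visitation M ν) := by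
    -- The product measure is read as a composition product of kernels over `Unit`, to which
    -- integrability of fibre integrals applies.
    have h := (show Integrable G₂ ((Kernel.const Unit (visitation M ν) ⊗ₖ
      Kernel.prodMkLeft Unit ν) ()) from hG₂).integral_compProd
    simpa only [Kernel.prodMkLeft_apply, Kernel.const_apply] using h
  have hgap_meas : ∀ y z, Measurable (smoothedAverage σ (π z) (smoothedCritic M σ (π y) (hπ y))) :=
    fun y z => measurable_smoothedAverage σ (hπ z) (hcrit y).measurable
  set gap : EuclideanSpace ℝ (Fin d) → S → ℝ := fun y s =>
    smoothedAverage σ (π y) (smoothedCritic M σ (π y) (hπ y)) s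
      - smoothedAverage σ (π θ) (smoothedCritic M σ (π y) (hπ y)) s
  have hgap : ∀ y s, |gap y s| ≤ C * K * σ⁻¹ * ‖π y s - π θ s‖ := fun y s =>
    abs_smoothedAverage_sub_le hσ hK (π θ) (π y) (hcrit y).measurable (hC y) s
  have igap : ∀ y, Integrable (gap y) (visitation M ν) := fun y =>
    Integrable.of_bound ((hgap_meas y y).sub (hgap_meas y θ)).aestronglyMeasurable (C + C)
      (Eventually.of_forall fun s => (abs_sub _ _).trans
        (add_le_add (abs_smoothedAverage_le σ _ (hC y) s) (abs_smoothedAverage_le σ _ (hC y) s)))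
  have hJ : ∀ y, smoothedObjective M σ (π y) (hπ y) - smoothedObjective M σ (π θ) (hπ θ)
      = ∫ s, gap y s ∂(visitation M ν) := fun y => by
    rw [← integral_smoothedAverage_sub hσ.le (hπ θ) (hπ y) (hcrit θ) (hcrit y)]
    exact (integral_sub
      (integrable_of_bounded _ (hgap_meas y y) (abs_smoothedAverage_le σ _ (hC y)))
      (integrable_of_bounded _ (hgap_meas θ θ) (abs_smoothedAverage_le σ _ (hC θ)))).symm
  have iinner : ∀ v, Integrable (fun s => inner ℝ (g s) v) (visitation M ν) := fun v =>
    hg.inner_const v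
  have hinner : ∀ v, inner ℝ (∫ p, G₂ p ∂μ) v = ∫ s, inner ℝ (g s) v ∂(visitation M ν) := by
    intro v
    rw [Measure.integral_compProd hG₂, real_inner_comm, ← integral_inner hg]
    simp only [real_inner_comm, g]
  rw [hasGradientAt_iff_tendsto]
  -- The whole difference quotient is one integral over states, so differentiability reduces to
  -- dominated convergence. At $y=\theta$ the inverse is $0$ by convention.
  have e : ∀ y, ‖y - θ‖⁻¹ * ‖smoothedObjective M σ (π y) (hπ y)
        - smoothedObjective M σ (π θ) (hπ θ) - inner ℝ (∫ p, G₂ p ∂μ) (y - θ)‖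
      = ‖∫ s, ‖y - θ‖⁻¹ * (gap y s - inner ℝ (g s) (y - θ)) ∂(visitation M ν)‖ := fun y => by
    rw [integral_const_mul, integral_sub (igap y) (iinner _), ← hJ, ← hinner, norm_mul, norm_inv,
      norm_norm]
  simp only [e]
  rw [← tendsto_zero_iff_norm_tendsto_zero, ← integral_zero S ℝ (μ := visitation M ν)]
  have hC0 : ∀ s : S, 0 ≤ C := fun s => (abs_nonneg _).trans (hC θ s 0)
  refine tendsto_integral_filter_of_dominated_convergence
    (fun s => C * K * σ⁻¹ * |L s| + ‖g s‖)
    (Eventually.of_forall fun y => (((igap y).sub (iinner _)).const_mul _).aestronglyMeasurable)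
    ?_ ((hL.abs.const_mul _).add hg.norm) ?_
  · filter_upwards [hLip'] with y hy
    refine Eventually.of_forall fun s => ?_
    rw [norm_mul, norm_inv, norm_norm]
    have hCK : 0 ≤ C * K * σ⁻¹ := mul_nonneg (mul_nonneg (hC0 s) hK0) (inv_nonneg.2 hσ.le)
    have h1 : ‖gap y s - inner ℝ (g s) (y - θ)‖ ≤ ‖y - θ‖ * (C * K * σ⁻¹ * |L s| + ‖g s‖) :=
      calc _ ≤ |gap y s| + |inner ℝ (g s) (y - θ)| := abs_sub _ _
        _ ≤ C * K * σ⁻¹ * (|L s| * ‖y - θ‖) + ‖g s‖ * ‖y - θ‖ :=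
            add_le_add ((hgap y s).trans (mul_le_mul_of_nonneg_left (hy s) hCK))
              (abs_real_inner_le_norm _ _)
        _ = _ := by ring
    exact inv_mul_le_of_le_mul₀ (norm_nonneg _) (by have := hC0 s; positivity) h1
  -- The fibre integral `g s` may be paired with a direction only where `G₂ (s, ·)` is integrable,
  -- which holds for almost every `s`.
  · filter_upwards [((Measure.integrable_compProd_iff hG₂.aestronglyMeasurable).1 hG₂).1] with s hs
    have hu : HasFDerivAt (fun y => σ⁻¹ • (π y s - π θ s))
        (σ⁻¹ • fderiv ℝ (fun θ' => π θ' s) θ) θ :=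
      ((hdiff s).hasFDerivAt.sub_const _).const_smul σ⁻¹
    have hmw : Measurable fun w : Action m => (s, π θ s + σ • w) := by fun_prop
    have ho := isLittleO_integral_shift hu (by simp)
      (f := fun y w => smoothedCritic M σ (π y) (hπ y) s (π θ s + σ • w))
      (fun y => (hcrit y).measurable.comp hmw) (fun y w => hC y s _) (fun w => hQlim s _)
    have ho' : (fun y => gap y s - inner ℝ (g s) (y - θ)) =o[𝓝 θ] fun y => y - θ := by
      refine ho.congr_left fun y => ?_
      simp only [gap, g]
      rw [smoothedAverage_eq_integral_add hσ.ne' (π θ) (π y),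
        inner_policyGradient_eq hσ hπ θ (y - θ) (hcrit θ).measurable s hs]
      rfl
    have h0 := ho'.norm_right.tendsto_div_nhds_zero
    simpa only [div_eq_inv_mul] using h0
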